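/- Let $\alpha>-1$ and $n\in\{0,1,2,\dots\}$. For $t\in\mathbb R$ let $P_n(x,t)$, $n\ge 0$, be the monic polynomials of degree $n$ orthogonal on $[-1,1]$ with respect to the weight $w(x,t)=(1-x^2)^\alpha e^{-tx^2}$, let $h_n(t)=\int_{-1}^1P_n(x,t)^2w(x,t)\,dx$, and let $\beta_n(t)$ be the coefficients of the recurrence $xP_n=P_{n+1}+\beta_nP_{n-1}$, that is, $\beta_0(t)=0$ and $\beta_n(t)=h_n(t)/h_{n-1}(t)$ for $n\ge1$. Then $\beta_n$ is twice differentiable on $\mathbb R$ and, for all $t\in\mathbb R$, writing $\beta_n=\beta_n(t)$ and $r_n=n-2t\beta_n(t)$, $$\begin{aligned} &\Big\{8t^2(t\beta_n'+\beta_n)(t\beta_n''+2\beta_n')+4t(2t-2n+1-2\alpha+4t\beta_n)(t\beta_n'+\beta_n)^2\\ &\quad-4t(t\beta_n'+\beta_n)\big[2n\alpha+2(n-2\alpha)r_n-3r_n^2\big]+4r_n^4-4(n-3\alpha+t)r_n^3\\ &\quad+4\big[n(t-3\alpha)-2\alpha(t-\alpha)\big]r_n^2+8n\alpha(t-\alpha)r_n\Big\}^2\\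 &=\Big[2t(t\beta_n''+2\beta_n')+(2t-2\alpha+1-2r_n)(t\beta_n'+\beta_n)+3r_n^2-2(n-2\alpha)r_n-2n\alpha\Big]^2\\ &\quad\times16t^2\Big[\beta_n r_n(n+2\alpha-2t\beta_n)+(t\beta_n'+\beta_n)^2\Big]. \end{aligned}$$ The initial values are $$\beta_n(0)=\frac{n(n+2\alpha)}{(2n-1+2\alpha)(2n+1+2\alpha)},$$ $$\beta_n'(0)=\frac{4n(n+\alpha)(n+2\alpha)(1-4\alpha^2)}{(2n-1+2\alpha)^2(2n+1+2\alpha)^2(2n-3+2\alpha)(2n+3+2\alpha)},$$ each whenever its denominator is nonzero. In the exceptional cases with $n\ge1$ (removable singularities of these formulas) one has $\beta_1(0)=\tfrac12$ and $\beta_1'(0)=-\tfrac18$ for $\alpha=-\tfrac12$; $\beta_1'(0)=-\tfrac1{16}$ for $\alpha=\tfrac12$; and $\beta_2'(0)=\tfrac1{16}$ for $\alpha=-\tfrac12$. -/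

import Mathlib

noncomputable section

namespace SemiJacobi

open Polynomial

/-- The symmetric semi-classical Jacobi weight `w(x,t) = (1 - x^2)^α * exp (-t x^2)`. -/
def weight (α t x : ℝ) : ℝ := (1 - x ^ 2) ^ α * Real.exp (-(t * x ^ 2))

/-- The linear functional `p ↦ ∫_{-1}^{1} p(x) w(x,t) dx`. -/
def functional (α t : ℝ) (p : ℝ[X]) : ℝ := ∫ x in (-1 : ℝ)..1, p.eval x * weight α t x

/-- The monic orthogonal polynomials `P_n(x,t)` for the weight `w(x,t)` on `[-1,1]`, obtained from
the monomials by the Gram–Schmidt process. -/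
def P (α t : ℝ) (n : ℕ) : ℝ[X] :=
  X ^ n - ∑ k : Fin n,
    C (functional α t (X ^ n * P α t k) / functional α t (P α t k * P α t k)) * P α t k
termination_by n
decreasing_by all_goals exact k.2

/-- `h_n(t) = ∫_{-1}^{1} P_n(x,t)^2 w(x,t) dx`. -/
def h (α : ℝ) (n : ℕ) (t : ℝ) : ℝ := functional α t (P α t n * P α t n)

/-- The recurrence coefficient `β_n(t) = h_n(t) / h_{n-1}(t)` for `n ≥ 1`, and `β_0(t) = 0`.
See `recurrence` below: `x P_n = P_{n+1} + β_n P_{n-1}`. -/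
def β (α : ℝ) : ℕ → ℝ → ℝ
  | 0, _ => 0
  | n + 1, t => h α (n + 1) t / h α n t

/-! The facts that justify these names: for `α > -1` the integrals converge, `P_n` is monic of
degree `n`, the `P_n` are orthogonal with `h_n > 0`, and the three-term recurrence holds. -/

theorem intervalIntegrable_base {α : ℝ} (hα : -1 < α) :
    IntervalIntegrable (fun x : ℝ => (1 - x ^ 2) ^ α) MeasureTheory.volume 0 1 := by
  have h1 : IntervalIntegrable (fun x : ℝ => (1 - x) ^ α) MeasureTheory.volume 0 1 := by
    have := (intervalIntegral.intervalIntegrable_rpow' (a := 0) (b := 1) hα).comp_sub_left 1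
    simpa using this.symm
  have h2 : ContinuousOn (fun x : ℝ => (1 + x) ^ α) (Set.uIcc 0 1) := by
    rw [Set.uIcc_of_le zero_le_one]
    intro x hx
    exact ContinuousAt.continuousWithinAt
      (ContinuousAt.rpow_const (by fun_prop) (Or.inl (by have := hx.1; linarith)))
  refine (h1.mul_continuousOn h2).congr ?_
  intro x hx
  rw [Set.uIoc_of_le zero_le_one] at hx
  have e : (1 : ℝ) - x ^ 2 = (1 - x) * (1 + x) := by ring
  simp only
  rw [e, Real.mul_rpow (by linarith [hx.2]) (by linarith [hx.1])]

theorem intervalIntegrable_weight {α : ℝ} (hα : -1 < α) (t : ℝ) (p : ℝ[X]) :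
    IntervalIntegrable (fun x : ℝ => p.eval x * weight α t x) MeasureTheory.volume (-1) 1 := by
  have h1 := intervalIntegrable_base hα
  have h2 : IntervalIntegrable (fun x : ℝ => (1 - x ^ 2) ^ α) MeasureTheory.volume (-1) 0 := by
    have := h1.comp_sub_left 0
    simpa using this.symm
  have h3 := (h2.trans h1).continuousOn_mul
    (f := fun x : ℝ => (1 - x ^ 2) ^ α) (g := fun x : ℝ => p.eval x * Real.exp (-(t * x ^ 2)))
    (Continuous.continuousOn (by fun_prop))
  refine h3.congr ?_
  intro x _
  simp only [weight]
  ring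

theorem functional_add {α : ℝ} (hα : -1 < α) (t : ℝ) (p q : ℝ[X]) :
    functional α t (p + q) = functional α t p + functional α t q := by
  unfold functional
  rw [← intervalIntegral.integral_add (intervalIntegrable_weight hα t p)
    (intervalIntegrable_weight hα t q)]
  simp [add_mul]

theorem functional_C_mul (α t c : ℝ) (p : ℝ[X]) :
    functional α t (C c * p) = c * functional α t p := by
  unfold functional
  rw [← intervalIntegral.integral_const_mul]
  simp [mul_assoc]

theorem functional_sub {α : ℝ} (hα : -1 < α) (t : ℝ) (p q : ℝ[X]) :
    functional α t (p - q) = functional α t p - functional α t q := by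
  have e : p - q = p + C (-1) * q := by simp [sub_eq_add_neg]
  rw [e, functional_add hα, functional_C_mul]
  ring

theorem functional_zero (α t : ℝ) : functional α t 0 = 0 := by simp [functional]

theorem functional_sum {α : ℝ} (hα : -1 < α) (t : ℝ) {ι : Type*} (s : Finset ι) (f : ι → ℝ[X]) :
    functional α t (∑ i ∈ s, f i) = ∑ i ∈ s, functional α t (f i) := by
  classical
  induction s using Finset.induction_on with
  | empty => simp [functional_zero]
  | insert a s ha ih => rw [Finset.sum_insert ha, Finset.sum_insert ha, functional_add hα, ih]

theorem weight_pos (α t : ℝ) {x : ℝ} (hx : x ∈ Set.Ioo (-1 : ℝ) 1) : 0 < weight α t x :=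
  mul_pos (Real.rpow_pos_of_pos (by nlinarith [hx.1, hx.2]) _) (Real.exp_pos _)

theorem functional_sq_pos {α : ℝ} (hα : -1 < α) (t : ℝ) {p : ℝ[X]} (hp : p ≠ 0) :
    0 < functional α t (p * p) := by
  unfold functional
  have hnn : ∀ x ∈ Set.Ioo (-1 : ℝ) 1, 0 ≤ (p * p).eval x * weight α t x := fun x hx => by
    rw [eval_mul]
    exact mul_nonneg (mul_self_nonneg _) (weight_pos α t hx).le
  rw [intervalIntegral.integral_of_le (by norm_num), MeasureTheory.integral_Ioc_eq_integral_Ioo,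
    MeasureTheory.setIntegral_pos_iff_support_of_nonneg_ae]
  · have hsub : Set.Ioo (-1 : ℝ) 1 \ (p.roots.toFinset : Set ℝ) ⊆
        (Function.support fun x => (p * p).eval x * weight α t x) ∩ Set.Ioo (-1) 1 := by
      rintro x ⟨hx, hr⟩
      refine ⟨?_, hx⟩
      have : p.eval x ≠ 0 := fun h0 => hr (by simp [hp, IsRoot, h0])
      simp [this, (weight_pos α t hx).ne']
    refine lt_of_lt_of_le ?_ (MeasureTheory.measure_mono hsub)
    rw [MeasureTheory.measure_sdiff_null (Set.Finite.measure_zero (Finset.finite_toSet _) _)]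
    simp
  · exact (MeasureTheory.ae_restrict_mem measurableSet_Ioo).mono hnn
  · exact ((intervalIntegrable_iff_integrableOn_Ioc_of_le (by norm_num)).1
      (intervalIntegrable_weight hα t (p * p))).mono_set Set.Ioo_subset_Ioc_self

theorem P_monic_and_degree (α t : ℝ) (n : ℕ) :
    (P α t n).Monic ∧ (P α t n).degree = n := by
  induction n using Nat.strong_induction_on with
  | _ n ih =>
    have hlt : (∑ k : Fin n,
        C (functional α t (X ^ n * P α t k) / functional α t (P α t k * P α t k)) *
          P α t k).degree < (n : WithBot ℕ) := by
      refine (Finset.sup_lt_iff (WithBot.bot_lt_coe n)).2 ?_ |>.trans_le' (degree_sum_le _ _)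
      intro k _
      have hle : (C (functional α t (X ^ n * P α t k) / functional α t (P α t k * P α t k)) *
          P α t k).degree ≤ (P α t k).degree := by
        rw [degree_mul]
        exact (add_le_add_left degree_C_le _).trans (zero_add _).le
      refine hle.trans_lt ?_
      rw [(ih k k.2).2]
      exact WithBot.coe_lt_coe.2 k.2
    rw [P]
    have hX : (X ^ n : ℝ[X]).degree = n := degree_X_pow n
    exact ⟨(monic_X_pow n).sub_of_left (by rwa [hX]),
      by rw [degree_sub_eq_left_of_degree_lt (by rwa [hX]), hX]⟩

theorem P_monic (α t : ℝ) (n : ℕ) : (P α t n).Monic := (P_monic_and_degree α t n).1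

theorem P_degree (α t : ℝ) (n : ℕ) : (P α t n).degree = n := (P_monic_and_degree α t n).2

theorem h_pos {α : ℝ} (hα : -1 < α) (n : ℕ) (t : ℝ) : 0 < h α n t :=
  functional_sq_pos hα t (P_monic α t n).ne_zero

theorem P_orthogonal_lt {α : ℝ} (hα : -1 < α) (t : ℝ) (n : ℕ) :
    ∀ m < n, functional α t (P α t n * P α t m) = 0 := by
  induction n using Nat.strong_induction_on with
  | _ n ih =>
    intro m hm
    have horth : ∀ k : Fin n, k ≠ ⟨m, hm⟩ → functional α t (P α t k * P α t m) = 0 := by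
      intro k hk
      rcases lt_or_gt_of_ne (fun e => hk (Fin.ext e) : (k : ℕ) ≠ m) with h1 | h1
      · rw [mul_comm]; exact ih m hm k h1
      · exact ih k k.2 m h1
    rw [P, sub_mul, Finset.sum_mul, functional_sub hα, functional_sum hα,
      Finset.sum_eq_single (⟨m, hm⟩ : Fin n)]
    · have hm0 : functional α t (P α t m * P α t m) ≠ 0 := (h_pos hα m t).ne'
      rw [mul_assoc, functional_C_mul, div_mul_cancel₀ _ hm0, sub_self]
    · intro k _ hk
      rw [mul_assoc, functional_C_mul, horth k hk, mul_zero]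
    · simp

/-- Orthogonality. -/
theorem P_orthogonal {α : ℝ} (hα : -1 < α) (t : ℝ) {m n : ℕ} (hmn : m ≠ n) :
    functional α t (P α t m * P α t n) = 0 := by
  rcases lt_or_gt_of_ne hmn with h1 | h1
  · rw [mul_comm]; exact P_orthogonal_lt hα t n m h1
  · exact P_orthogonal_lt hα t m n h1

theorem degree_sub_P_lt (α t : ℝ) (n : ℕ) {q : ℝ[X]} (hq : q.degree < (n + 1 : ℕ)) :
    (q - C (q.coeff n) * P α t n).degree < n := by
  rw [degree_lt_iff_coeff_zero] at hq ⊢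
  intro m hm
  have hP : (P α t n).coeff n = 1 := by
    have := P_monic α t n
    rwa [Monic, leadingCoeff, natDegree_eq_of_degree_eq_some (P_degree α t n)] at this
  rcases hm.eq_or_lt with rfl | hlt
  · simp [hP]
  · have hz : (P α t n).coeff m = 0 :=
      coeff_eq_zero_of_degree_lt (by rw [P_degree]; exact_mod_cast hlt)
    simp [hq m hlt, hz]

theorem P_orthogonal_of_degree_lt {α : ℝ} (hα : -1 < α) (t : ℝ) (n k : ℕ) (hk : k ≤ n) :
    ∀ q : ℝ[X], q.degree < k → functional α t (P α t n * q) = 0 := by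
  induction k with
  | zero =>
    intro q hq
    have : q = 0 := by simpa [Nat.WithBot.lt_zero_iff] using hq
    simp [this, functional_zero]
  | succ k ih =>
    intro q hq
    have h1 := ih (by omega) _ (degree_sub_P_lt α t k hq)
    have e : P α t n * q = P α t n * (q - C (q.coeff k) * P α t k) +
        C (q.coeff k) * (P α t n * P α t k) := by ring
    rw [e, functional_add hα, h1, functional_C_mul, P_orthogonal hα t (by omega)]
    simp

theorem functional_comp_neg (α t : ℝ) (p : ℝ[X]) :
    functional α t (p.comp (-X)) = functional α t p := by
  unfold functional
  have := intervalIntegral.integral_comp_neg (a := -1) (b := 1)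
    (fun x => p.eval x * weight α t x)
  rw [neg_neg] at this
  rw [← this]
  simp [weight]

theorem functional_odd {α t : ℝ} {p : ℝ[X]} (hp : p.comp (-X) = -p) : functional α t p = 0 := by
  have h1 := functional_comp_neg α t p
  have h2 : functional α t (-p) = -functional α t p := by
    have := functional_C_mul α t (-1) p
    simpa using this
  rw [hp, h2] at h1
  linarith

theorem P_comp_neg (α t : ℝ) (n : ℕ) : (P α t n).comp (-X) = (-1) ^ n * P α t n := by
  induction n using Nat.strong_induction_on with
  | _ n ih =>
    have key : ∀ k : Fin n,
        (C (functional α t (X ^ n * P α t k) / functional α t (P α t k * P α t k)) *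
          P α t k).comp (-X) = (-1) ^ n *
        (C (functional α t (X ^ n * P α t k) / functional α t (P α t k * P α t k)) *
          P α t k) := by
      intro k
      rw [mul_comp, C_comp, ih k k.2]
      by_cases hpar : (-1 : ℝ[X]) ^ (k : ℕ) = (-1) ^ n
      · rw [hpar]; ring
      · have hodd : (-1 : ℝ[X]) ^ n * (-1) ^ (k : ℕ) = -1 := by
          rcases neg_one_pow_eq_or ℝ[X] n with a | a <;>
          rcases neg_one_pow_eq_or ℝ[X] (k : ℕ) with b | b <;> simp_all
        have hz : functional α t (X ^ n * P α t k) = 0 := by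
          apply functional_odd
          rw [mul_comp, ih k k.2, X_pow_comp, neg_pow]
          linear_combination (X ^ n * P α t k) * hodd
        simp [hz]
    have hsum : ∀ f : Fin n → ℝ[X], (∑ k, f k).comp (-X) = ∑ k, (f k).comp (-X) := fun f =>
      map_sum (compRingHom (-X)) f Finset.univ
    rw [P, sub_comp, hsum, Finset.sum_congr rfl (fun k _ => key k), ← Finset.mul_sum,
      X_pow_comp, neg_pow]
    ring

/-- The three-term recurrence `x P_0 = P_1`, `x P_{n+1} = P_{n+2} + β_{n+1} P_n`. -/
theorem recurrence {α : ℝ} (hα : -1 < α) (t : ℝ) :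
    P α t 0 = 1 ∧ X * P α t 0 = P α t 1 ∧
    ∀ n : ℕ, X * P α t (n + 1) = P α t (n + 2) + C (β α (n + 1) t) * P α t n := by
  have h0 : P α t 0 = 1 := by rw [P]; simp
  have hodd : ∀ n, functional α t (X * P α t n * P α t n) = 0 := fun n => by
    apply functional_odd
    have hs : ((-1 : ℝ[X]) ^ n) * (-1) ^ n = 1 := by rw [← mul_pow]; simp
    simp only [mul_comp, P_comp_neg, X_comp]
    linear_combination (-X * P α t n * P α t n) * hs
  have hX : ∀ n : ℕ, (X * P α t n - P α t (n + 1)).degree < ((n + 1 : ℕ) : WithBot ℕ) := fun n => by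
    have hd : (X * P α t n).degree = ((n + 1 : ℕ) : WithBot ℕ) := by
      rw [degree_mul, P_degree, degree_X]; push_cast; ring
    have hm : (X * P α t n).Monic := monic_X.mul (P_monic α t n)
    rw [← hd]
    exact degree_sub_lt_left (by rw [hd, P_degree]) hm.ne_zero
      (hm.leadingCoeff.trans (P_monic α t (n + 1)).leadingCoeff.symm)
  have hself : ∀ q : ℝ[X], functional α t (q * q) = 0 → q = 0 := fun q hq => by
    by_contra hne
    exact (functional_sq_pos hα t hne).ne' hq
  have hXP : ∀ n, functional α t (X * P α t n * P α t (n + 1)) = h α (n + 1) t := fun n => by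
    have e : X * P α t n * P α t (n + 1) = P α t (n + 1) * (X * P α t n - P α t (n + 1)) +
      P α t (n + 1) * P α t (n + 1) := by ring
    rw [e, functional_add hα, P_orthogonal_of_degree_lt hα t (n + 1) (n + 1) le_rfl _ (hX n),
      zero_add, h]
  refine ⟨h0, ?_, fun n => ?_⟩
  · refine sub_eq_zero.1 (hself _ ?_)
    set Q := X * P α t 0 - P α t 1 with hQ
    have hQ0 := P_orthogonal_of_degree_lt hα t 1 1 le_rfl Q (hX 0)
    have hQ1 : Q = C (Q.coeff 0) := by
      have hc := hX 0
      rw [degree_lt_iff_coeff_zero] at hc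
      ext m
      cases m with
      | zero => simp
      | succ m => rw [coeff_C_succ]; exact hc _ (by omega)
    have h1 : functional α t Q = 0 := by
      have a1 : functional α t (X * P α t 0 * P α t 0) = 0 := hodd 0
      have a2 : functional α t (P α t 1 * P α t 0) = 0 := P_orthogonal hα t one_ne_zero
      rw [h0, mul_one] at a1 a2
      rw [hQ, functional_sub hα, h0, a1, a2, sub_zero]
    nth_rewrite 1 [hQ1]
    rw [functional_C_mul, h1, mul_zero]
  · refine sub_eq_zero.1 (hself _ ?_)
    set Q := X * P α t (n + 1) - (P α t (n + 2) + C (β α (n + 1) t) * P α t n) with hQ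
    have hQ1 : functional α t (Q * P α t (n + 1)) = 0 := by
      have e : Q * P α t (n + 1) = X * P α t (n + 1) * P α t (n + 1) -
          (P α t (n + 2) * P α t (n + 1) + C (β α (n + 1) t) * (P α t n * P α t (n + 1))) := by
        rw [hQ]; ring
      rw [e, functional_sub hα, functional_add hα, functional_C_mul, hodd,
        P_orthogonal hα t (by omega : n + 2 ≠ n + 1), P_orthogonal hα t (by omega : n ≠ n + 1)]
      ring
    have hQ2 : functional α t (Q * P α t n) = 0 := by
      have e : Q * P α t n = X * P α t n * P α t (n + 1) -
          (P α t (n + 2) * P α t n + C (β α (n + 1) t) * (P α t n * P α t n)) := by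
        rw [hQ]; ring
      have hb : β α (n + 1) t * functional α t (P α t n * P α t n) = h α (n + 1) t :=
        div_mul_cancel₀ _ (h_pos hα n t).ne'
      rw [e, functional_sub hα, functional_add hα, functional_C_mul, hXP, hb,
        P_orthogonal hα t (by omega : n + 2 ≠ n)]
      ring
    have hQ3 : ∀ r : ℝ[X], r.degree < (n : WithBot ℕ) → functional α t (Q * r) = 0 := fun r hr => by
      have e : Q * r = P α t (n + 1) * (X * r) -
          (P α t (n + 2) * r + C (β α (n + 1) t) * (P α t n * r)) := by
        rw [hQ]; ring
      have hXr : (X * r).degree < ((n + 1 : ℕ) : WithBot ℕ) := by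
        rw [degree_lt_iff_coeff_zero] at hr ⊢
        intro m hm
        obtain ⟨m, rfl⟩ : ∃ k, m = k + 1 := ⟨m - 1, by omega⟩
        rw [coeff_X_mul]
        exact hr m (by omega)
      rw [e, functional_sub hα, functional_add hα, functional_C_mul,
        P_orthogonal_of_degree_lt hα t (n + 1) (n + 1) le_rfl _ hXr,
        P_orthogonal_of_degree_lt hα t (n + 2) n (by omega) _ hr,
        P_orthogonal_of_degree_lt hα t n n le_rfl _ hr]
      ring
    have hdeg : Q.degree < ((n + 1 + 1 : ℕ) : WithBot ℕ) := by
      have e : Q = (X * P α t (n + 1) - P α t (n + 2)) - C (β α (n + 1) t) * P α t n := by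
        rw [hQ]; ring
      have hc := hX (n + 1)
      rw [degree_lt_iff_coeff_zero] at hc ⊢
      intro m hm
      have hz : (P α t n).coeff m = 0 :=
        coeff_eq_zero_of_degree_lt (by rw [P_degree]; exact_mod_cast (by omega : n < m))
      rw [e, coeff_sub, hc m hm, coeff_C_mul, hz]
      ring
    have d1 := degree_sub_P_lt α t (n + 1) hdeg
    have d2 := degree_sub_P_lt α t n d1
    set Q' := Q - C (Q.coeff (n + 1)) * P α t (n + 1) with hQ'
    have e : Q * Q = Q * (Q' - C (Q'.coeff n) * P α t n) +
        (C (Q'.coeff n) * (Q * P α t n) + C (Q.coeff (n + 1)) * (Q * P α t (n + 1))) := by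
      have : Q = Q' + C (Q.coeff (n + 1)) * P α t (n + 1) := by rw [hQ']; ring
      linear_combination Q * this
    rw [e, functional_add hα, functional_add hα, functional_C_mul, functional_C_mul, hQ1, hQ2,
      hQ3 _ d2]
    ring

/-- Uniqueness: `P_n` is the only monic polynomial of degree `n` that is orthogonal to all
polynomials of lower degree. -/
theorem P_unique {α : ℝ} (hα : -1 < α) (t : ℝ) (n : ℕ) (q : ℝ[X]) (hm : q.Monic)
    (hd : q.degree = (n : WithBot ℕ))
    (hq : ∀ r : ℝ[X], r.degree < (n : WithBot ℕ) → functional α t (q * r) = 0) :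
    q = P α t n := by
  have hlt : (q - P α t n).degree < (n : WithBot ℕ) := by
    rw [← hd]
    exact degree_sub_lt_left (by rw [hd, P_degree]) hm.ne_zero
      (hm.leadingCoeff.trans (P_monic α t n).leadingCoeff.symm)
  by_contra hne
  have hpos := functional_sq_pos hα t (sub_ne_zero.2 hne)
  rw [sub_mul, functional_sub hα, hq _ hlt, P_orthogonal_of_degree_lt hα t n n le_rfl _ hlt] at hpos
  simp at hpos

end SemiJacobi

end

/-!
The argument rests on two sets of relations between the `β_n`, one in `t` and one in `n`.

The `t`-evolution. Moments of the weight can be differentiated under the integral sign, and by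
induction along the three-term recurrence the coefficients of `P_n`, the norms `h_n` and the `β_n`
are differentiable. As `P_n` minimises the norm among monic polynomials of degree `n`,
`h_n' = -∫ x² P_n² w = -(β_n + β_{n+1}) h_n` (`deriv_h`), which gives the Toda equation
`β_n' = β_n (β_{n-1} - β_{n+1})` (`deriv_β`).

The `n`-recurrence. The Pearson equation of the weight, tested on `P_n P_{n-1}`, gives a string
equation containing `∑_{j<n} β_j` (`string_equation`). Its difference in `n` is free of that sum
(`string_equation_sub`), and multiplied by `R_n = 2n + 1 + 2α - 2t (β_n + β_{n+1})` it telescopes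
to the first integral `r_n (r_n + 2α) = β_n R_n R_{n-1}` (`β_mul_R_mul_R`).

Write `q = (t β_n)'`. The Toda equation says `2q = β_n (R_n - R_{n-1})`, so the first integral gives
`16 t² (β_n r_n (r_n + 2α) + q²) = X²` with `X = 2 t β_n (R_n + R_{n-1})`: the last factor of the
differential equation is a perfect square. Differentiating once more and eliminating `β_{n±2}` with
the differenced string equations expresses `t q'` through `β_n`, `R_n`, `R_{n-1}`
(`four_mul_deriv_deriv_mul_β`). An elimination modulo the first integral then shows that the first
brace of the differential equation equals `-X` times the bracket (`unsquared_ode`), and squaring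
finishes. No step divides by `t`, `q` or `X`.

At `t = 0` the first integral reads `β_n(0) (2n - 1 + 2α) (2n + 1 + 2α) = n (n + 2α)`, and
`β_n'(0)` follows from the Toda equation.
-/

noncomputable section

namespace SemiJacobi

open Polynomial

/-! ### The functional: dependence on the parameter and the Pearson equation -/

theorem hasDerivAt_functional {α : ℝ} (hα : -1 < α) (p : ℝ[X]) (t : ℝ) :
    HasDerivAt (fun s => functional α s p) (-functional α t (X ^ 2 * p)) t := by
  have hmeas : ∀ (s : ℝ) (q : ℝ[X]), MeasureTheory.AEStronglyMeasurable
      (fun x => q.eval x * weight α s x)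
      (MeasureTheory.volume.restrict (Set.uIoc (-1 : ℝ) 1)) := fun s q =>
    (intervalIntegrable_weight hα s q).def'.aestronglyMeasurable
  have key := (intervalIntegral.hasDerivAt_integral_of_dominated_loc_of_deriv_le
    (μ := MeasureTheory.volume) (a := (-1 : ℝ)) (b := 1)
    (F := fun s x => p.eval x * weight α s x)
    (F' := fun s x => (-(X ^ 2 * p)).eval x * weight α s x)
    (bound := fun x => ‖(X ^ 2 * p).eval x * weight α (t - 1) x‖)
    (x₀ := t) (Ioi_mem_nhds (by linarith : t - 1 < t))
    (Filter.Eventually.of_forall fun s => hmeas s p)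
    (intervalIntegrable_weight hα t p) (hmeas t _) ?_
    (intervalIntegrable_weight hα (t - 1) _).norm ?_).2
  · refine HasDerivAt.congr_deriv key ?_
    simp [functional]
  · refine Filter.Eventually.of_forall fun x _ s hs => ?_
    have hs' : t - 1 < s := hs
    simp only [eval_neg, norm_mul, norm_neg, weight]
    gcongr ?_ * (_ * ?_)
    rw [Real.norm_of_nonneg (Real.exp_pos _).le, Real.norm_of_nonneg (Real.exp_pos _).le]
    exact Real.exp_le_exp.2 (by nlinarith [sq_nonneg x])
  · refine Filter.Eventually.of_forall fun x _ s _ => ?_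
    have h1 : HasDerivAt (fun s : ℝ => Real.exp (-(s * x ^ 2)))
        (Real.exp (-(s * x ^ 2)) * (-(1 * x ^ 2))) s :=
      ((hasDerivAt_id s).mul_const (x ^ 2)).neg.exp
    have h2 := (h1.const_mul ((1 - x ^ 2) ^ α)).const_mul (p.eval x)
    refine HasDerivAt.congr_deriv h2 ?_
    simp only [eval_neg, eval_mul, eval_pow, eval_X, weight]
    ring

/-- The Pearson equation of the weight, `((1 - x²) w)' = -(2 (1 + α + t) x - 2 t x³) w`, in weak
form: the boundary terms vanish because `α + 1 > 0`. -/
theorem functional_pearson {α : ℝ} (hα : -1 < α) (t : ℝ) (q : ℝ[X]) :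
    functional α t ((1 - X ^ 2) * derivative q) =
      functional α t ((C (2 * (1 + α + t)) * X - C (2 * t) * X ^ 3) * q) := by
  rw [← sub_eq_zero, ← functional_sub hα]
  have hcont : ContinuousOn
      (fun x : ℝ => q.eval x * ((1 - x ^ 2) ^ (α + 1) * Real.exp (-(t * x ^ 2))))
      (Set.Icc (-1) 1) := by
    have h1 : Continuous fun x : ℝ => (1 - x ^ 2) ^ (α + 1) :=
      (by fun_prop : Continuous fun x : ℝ => 1 - x ^ 2).rpow_const
        fun x => Or.inr (by linarith)
    exact Continuous.continuousOn (by fun_prop)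
  have hderiv : ∀ x ∈ Set.Ioo (-1 : ℝ) 1, HasDerivAt
      (fun x : ℝ => q.eval x * ((1 - x ^ 2) ^ (α + 1) * Real.exp (-(t * x ^ 2))))
      (((1 - X ^ 2) * derivative q -
        (C (2 * (1 + α + t)) * X - C (2 * t) * X ^ 3) * q).eval x * weight α t x) x := by
    intro x hx
    have hpos : 0 < 1 - x ^ 2 := by nlinarith [hx.1, hx.2]
    have h1 : HasDerivAt (fun x : ℝ => (1 - x ^ 2) ^ (α + 1))
        ((-(2 * x)) * (α + 1) * (1 - x ^ 2) ^ α) x := by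
      have := (((hasDerivAt_pow 2 x).const_sub 1).rpow_const (p := α + 1) (Or.inl hpos.ne'))
      simpa using this
    have h2 : HasDerivAt (fun x : ℝ => Real.exp (-(t * x ^ 2)))
        (Real.exp (-(t * x ^ 2)) * (-(t * (2 * x)))) x := by
      have := (((hasDerivAt_pow 2 x).const_mul t).neg).exp
      simpa using this
    refine HasDerivAt.congr_deriv ((q.hasDerivAt x).mul (h1.mul h2)) ?_
    have h3 : (1 - x ^ 2) ^ (α + 1) = (1 - x ^ 2) ^ α * (1 - x ^ 2) := by
      rw [Real.rpow_add hpos, Real.rpow_one]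
    simp only [eval_sub, eval_mul, eval_pow, eval_X, eval_C, eval_one, weight, h3]
    ring
  have := intervalIntegral.integral_eq_sub_of_hasDerivAt_of_le (by norm_num) hcont hderiv
    (intervalIntegrable_weight hα t _)
  rw [functional, this]
  have h0 : (0 : ℝ) ^ (α + 1) = 0 := Real.zero_rpow (by linarith)
  simp [h0]

/-! ### Differentiability of the recurrence coefficients -/

theorem differentiable_functional {α : ℝ} (hα : -1 < α) {p : ℝ → ℝ[X]} {N : ℕ}
    (hN : ∀ t, (p t).natDegree < N) (hp : ∀ k, Differentiable ℝ fun t => (p t).coeff k) :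
    Differentiable ℝ fun t => functional α t (p t) := by
  have e : (fun t => functional α t (p t)) =
      fun t => ∑ k ∈ Finset.range N, (p t).coeff k * functional α t (X ^ k) := by
    ext t
    conv_lhs => rw [(p t).as_sum_range' N (hN t), functional_sum hα]
    refine Finset.sum_congr rfl fun k _ => ?_
    rw [← C_mul_X_pow_eq_monomial, functional_C_mul]
  rw [e]
  exact Differentiable.fun_sum fun k _ =>
    (hp k).mul fun t => (hasDerivAt_functional hα (X ^ k) t).differentiableAt

theorem P_natDegree (α t : ℝ) (n : ℕ) : (P α t n).natDegree = n :=
  natDegree_eq_of_degree_eq_some (P_degree α t n)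

theorem differentiable_h_of_coeff {α : ℝ} (hα : -1 < α) {n : ℕ}
    (hP : ∀ k, Differentiable ℝ fun t => (P α t n).coeff k) : Differentiable ℝ (h α n) := by
  refine differentiable_functional hα (p := fun t => P α t n * P α t n) (N := n + n + 1)
    (fun t => ?_) (fun k => ?_)
  · have := natDegree_mul_le (p := P α t n) (q := P α t n)
    rw [P_natDegree] at this
    omega
  · simp only [coeff_mul]
    exact Differentiable.fun_sum fun x _ => (hP _).mul (hP _)

theorem differentiable_coeff_P {α : ℝ} (hα : -1 < α) (n : ℕ) :
    ∀ k, Differentiable ℝ fun t => (P α t n).coeff k := by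
  induction n using Nat.twoStepInduction with
  | zero =>
    intro k
    simp only [fun t => (recurrence hα t).1]
    exact differentiable_const _
  | one =>
    intro k
    simp only [fun t => (recurrence hα t).2.1.symm, fun t => (recurrence hα t).1]
    exact differentiable_const _
  | more n ih₀ ih₁ =>
    have hβ : Differentiable ℝ (β α (n + 1)) :=
      (differentiable_h_of_coeff hα ih₁).div (differentiable_h_of_coeff hα ih₀)
        fun t => (h_pos hα n t).ne'
    intro k
    have e : ∀ t, P α t (n + 2) = X * P α t (n + 1) - C (β α (n + 1) t) * P α t n := fun t =>
      eq_sub_of_add_eq ((recurrence hα t).2.2 n).symm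
    simp only [e, coeff_sub, coeff_C_mul]
    refine Differentiable.fun_sub ?_ (hβ.mul (ih₀ k))
    cases k with
    | zero => simp
    | succ k => simpa only [coeff_X_mul] using ih₁ k

theorem differentiable_h {α : ℝ} (hα : -1 < α) (n : ℕ) : Differentiable ℝ (h α n) :=
  differentiable_h_of_coeff hα (differentiable_coeff_P hα n)

theorem differentiable_β {α : ℝ} (hα : -1 < α) : ∀ n, Differentiable ℝ (β α n)
  | 0 => differentiable_const 0
  | n + 1 => (differentiable_h hα (n + 1)).div (differentiable_h hα n) fun t => (h_pos hα n t).ne'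

/-! ### The Toda equation -/

/-- Among monic polynomials of degree `n`, the orthogonal one has the least norm. -/
theorem h_le_functional {α : ℝ} (hα : -1 < α) (t : ℝ) (n : ℕ) {q : ℝ[X]} (hm : q.Monic)
    (hd : q.degree = (n : WithBot ℕ)) : h α n t ≤ functional α t (q * q) := by
  have hlt : (q - P α t n).degree < (n : WithBot ℕ) := by
    rw [← hd]
    exact degree_sub_lt_left (by rw [hd, P_degree]) hm.ne_zero
      (hm.leadingCoeff.trans (P_monic α t n).leadingCoeff.symm)
  have e : q * q = P α t n * P α t n + (C 2 * (P α t n * (q - P α t n)) +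
      (q - P α t n) * (q - P α t n)) := by
    rw [show (C 2 : ℝ[X]) = 2 from rfl]; ring
  have h0 : 0 ≤ functional α t ((q - P α t n) * (q - P α t n)) := by
    by_cases hz : q - P α t n = 0
    · simp [hz, functional_zero]
    · exact (functional_sq_pos hα t hz).le
  rw [e, functional_add hα, functional_add hα, functional_C_mul,
    P_orthogonal_of_degree_lt hα t n n le_rfl _ hlt]
  rw [h]
  linarith

/-- The function `s ↦ ∫ P_n(x,t)² w(x,s) dx - h_n(s)` is nonnegative and vanishes at `s = t`, so its
derivative there is zero: the variation of `P_n` does not contribute to `h_n'`. -/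
theorem deriv_h {α : ℝ} (hα : -1 < α) (n : ℕ) (t : ℝ) :
    deriv (h α n) t = -functional α t (X ^ 2 * (P α t n * P α t n)) := by
  have hd := (hasDerivAt_functional hα (P α t n * P α t n) t).sub
    (differentiable_h hα n t).hasDerivAt
  have hmin : IsLocalMin ((fun s => functional α s (P α t n * P α t n)) - h α n) t := by
    refine Filter.Eventually.of_forall fun s => ?_
    have h1 := h_le_functional hα s n (P_monic α t n) (P_degree α t n)
    have h2 : h α n t = functional α t (P α t n * P α t n) := rfl
    simp only [Pi.sub_apply]
    linarith
  linarith [hmin.hasDerivAt_eq_zero hd]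

theorem β_zero (α t : ℝ) : β α 0 t = 0 := rfl

theorem β_succ_mul_h {α : ℝ} (hα : -1 < α) (t : ℝ) (n : ℕ) :
    β α (n + 1) t * h α n t = h α (n + 1) t :=
  div_mul_cancel₀ _ (h_pos hα n t).ne'

/-- The three-term recurrence with truncated index: for `n = 0` the last term vanishes. -/
theorem X_mul_P {α : ℝ} (hα : -1 < α) (t : ℝ) (n : ℕ) :
    X * P α t n = P α t (n + 1) + C (β α n t) * P α t (n - 1) := by
  cases n with
  | zero => simpa [β_zero] using (recurrence hα t).2.1
  | succ n => exact (recurrence hα t).2.2 n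

theorem β_mul_h_pred {α : ℝ} (hα : -1 < α) (t : ℝ) (n : ℕ) :
    β α n t * functional α t (P α t (n - 1) * P α t (n - 1)) * β α n t = β α n t * h α n t := by
  cases n with
  | zero => simp [β_zero]
  | succ n =>
    have := β_succ_mul_h hα t n
    simp only [h] at this ⊢
    rw [Nat.add_sub_cancel, this, mul_comm]

theorem functional_X_sq_mul_P_sq {α : ℝ} (hα : -1 < α) (t : ℝ) (n : ℕ) :
    functional α t (X ^ 2 * (P α t n * P α t n)) = (β α n t + β α (n + 1) t) * h α n t := by
  have e : X ^ 2 * (P α t n * P α t n) = P α t (n + 1) * P α t (n + 1) +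
      (C (2 * β α n t) * (P α t (n + 1) * P α t (n - 1)) +
        C (β α n t) * (C (β α n t) * (P α t (n - 1) * P α t (n - 1)))) := by
    rw [C_mul, show (C 2 : ℝ[X]) = 2 from rfl]
    linear_combination (X * P α t n + P α t (n + 1) + C (β α n t) * P α t (n - 1)) * X_mul_P hα t n
  rw [e, functional_add hα, functional_add hα, functional_C_mul, functional_C_mul,
    functional_C_mul, P_orthogonal hα t (by omega : n + 1 ≠ n - 1), ← h]
  linear_combination β_mul_h_pred hα t n - β_succ_mul_h hα t n

/-- The Toda equation. Both sides vanish for `n = 0`, where the index `n - 1` is truncated. -/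
theorem deriv_β {α : ℝ} (hα : -1 < α) (n : ℕ) (t : ℝ) :
    deriv (β α n) t = β α n t * (β α (n - 1) t - β α (n + 1) t) := by
  cases n with
  | zero =>
    have : β α 0 = fun _ => 0 := rfl
    simp [this]
  | succ n =>
    have h0 := (h_pos hα n t).ne'
    have hd := ((differentiable_h hα (n + 1) t).hasDerivAt.div
      (differentiable_h hα n t).hasDerivAt h0).deriv
    have e : β α (n + 1) = h α (n + 1) / h α n := rfl
    rw [e, hd, deriv_h hα, deriv_h hα, functional_X_sq_mul_P_sq hα, functional_X_sq_mul_P_sq hα,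
      ← e, ← β_succ_mul_h hα t n, Nat.add_sub_cancel]
    field_simp
    ring

/-! ### Integrals of products of consecutive orthogonal polynomials -/

theorem functional_P_mul {α : ℝ} (hα : -1 < α) (t : ℝ) (n : ℕ) {q : ℝ[X]}
    (hq : q.degree < (n + 1 : ℕ)) : functional α t (P α t n * q) = q.coeff n * h α n t := by
  have e : P α t n * q = P α t n * (q - C (q.coeff n) * P α t n) +
      C (q.coeff n) * (P α t n * P α t n) := by ring
  rw [e, functional_add hα, functional_C_mul,
    P_orthogonal_of_degree_lt hα t n n le_rfl _ (degree_sub_P_lt α t n hq), zero_add, h]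

theorem P_coeff_self (α t : ℝ) (n : ℕ) : (P α t n).coeff n = 1 := by
  have := P_monic α t n
  rwa [Monic, leadingCoeff, P_natDegree] at this

theorem P_coeff_of_lt (α t : ℝ) {n k : ℕ} (hk : n < k) : (P α t n).coeff k = 0 :=
  coeff_eq_zero_of_natDegree_lt (by rwa [P_natDegree])

theorem P_coeff_pred {α : ℝ} (hα : -1 < α) (t : ℝ) (n : ℕ) : (P α t (n + 1)).coeff n = 0 := by
  induction n with
  | zero => simp [← (recurrence hα t).2.1]
  | succ n ih =>
    have := congrArg (fun p => p.coeff (n + 1)) ((recurrence hα t).2.2 n)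
    simp only [coeff_X_mul, coeff_add, coeff_C_mul, ih, P_coeff_of_lt α t n.lt_succ_self] at this
    linarith

theorem P_coeff_pred_pred {α : ℝ} (hα : -1 < α) (t : ℝ) (n : ℕ) :
    (P α t (n + 2)).coeff n = -∑ j ∈ Finset.range (n + 2), β α j t := by
  induction n with
  | zero =>
    have := congrArg (fun p => p.coeff 0) ((recurrence hα t).2.2 0)
    simp only [coeff_X_mul_zero, coeff_add, coeff_C_mul, P_coeff_self] at this
    simp [Finset.sum_range_succ, β_zero]
    linarith
  | succ n ih =>
    have := congrArg (fun p => p.coeff (n + 1)) ((recurrence hα t).2.2 (n + 1))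
    simp only [coeff_X_mul, coeff_add, coeff_C_mul, ih, P_coeff_self] at this
    rw [Finset.sum_range_succ]
    linarith

theorem functional_derivative_P_mul {α : ℝ} (hα : -1 < α) (t : ℝ) (n : ℕ) :
    functional α t (derivative (P α t (n + 1)) * P α t n) = (n + 1) * h α n t := by
  rw [mul_comm, functional_P_mul hα]
  · rw [coeff_derivative, P_coeff_self, one_mul]
  · exact (degree_derivative_lt (P_monic α t _).ne_zero).trans_eq (P_degree α t _)

theorem functional_P_mul_derivative {α : ℝ} (hα : -1 < α) (t : ℝ) (n : ℕ) :
    functional α t (P α t (n + 1) * derivative (P α t n)) = 0 := by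
  refine P_orthogonal_of_degree_lt hα t _ _ le_rfl _ ?_
  refine (degree_derivative_lt (P_monic α t n).ne_zero).trans ?_
  rw [P_degree]
  exact_mod_cast n.lt_succ_self

theorem functional_P_mul_X_sq_derivative {α : ℝ} (hα : -1 < α) (t : ℝ) (n : ℕ) :
    functional α t (P α t (n + 1) * (X ^ 2 * derivative (P α t n))) = n * h α (n + 1) t := by
  have hc : ∀ k, (X ^ 2 * derivative (P α t n)).coeff (k + 1) = (P α t n).coeff k * k := by
    intro k
    rw [pow_two, mul_assoc, coeff_X_mul]
    cases k with
    | zero => simp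
    | succ k => rw [coeff_X_mul, coeff_derivative]; push_cast; ring
  rw [functional_P_mul hα, hc, P_coeff_self, one_mul]
  rw [degree_lt_iff_coeff_zero]
  intro m hm
  obtain ⟨m, rfl⟩ : ∃ k, m = k + 1 := ⟨m - 1, by omega⟩
  rw [hc, P_coeff_of_lt α t (by omega), zero_mul]

/-- The two leading terms of the Euler derivative `x P_n'` in the orthogonal basis. -/
theorem degree_euler_P_lt {α : ℝ} (hα : -1 < α) (t : ℝ) (n : ℕ) :
    (X * derivative (P α t (n + 2)) - C (n + 2 : ℝ) * P α t (n + 2) -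
      C (2 * ∑ j ∈ Finset.range (n + 2), β α j t) * P α t n).degree < (n : WithBot ℕ) := by
  have hc : ∀ k, (X * derivative (P α t (n + 2))).coeff k = (P α t (n + 2)).coeff k * k := by
    intro k
    cases k with
    | zero => simp
    | succ k => rw [coeff_X_mul, coeff_derivative]; push_cast; ring
  rw [degree_lt_iff_coeff_zero]
  intro m hm
  simp only [coeff_sub, hc, coeff_C_mul]
  obtain rfl | rfl | rfl | h3 : m = n ∨ m = n + 1 ∨ m = n + 2 ∨ n + 2 < m := by omega
  · rw [P_coeff_self, P_coeff_pred_pred hα]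
    ring
  · rw [P_coeff_pred hα, P_coeff_of_lt α t (by omega : n < n + 1)]
    ring
  · rw [P_coeff_self, P_coeff_of_lt α t (by omega : n < n + 2)]
    push_cast
    ring
  · rw [P_coeff_of_lt α t h3, P_coeff_of_lt α t (by omega : n < m)]
    ring

theorem functional_X_sq_derivative_P_mul {α : ℝ} (hα : -1 < α) (t : ℝ) (n : ℕ) :
    functional α t (X ^ 2 * derivative (P α t (n + 1)) * P α t n) =
      (n + 1) * h α (n + 1) t + 2 * (∑ j ∈ Finset.range (n + 1), β α j t) * h α n t := by
  cases n with
  | zero =>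
    have e : X ^ 2 * derivative (P α t 1) * P α t 0 = P α t 1 * P α t 1 := by
      rw [← (recurrence hα t).2.1, (recurrence hα t).1]
      simp [pow_two]
    rw [e]
    simp [h, β_zero]
  | succ n =>
    set s := ∑ j ∈ Finset.range (n + 1 + 1), β α j t with hs
    have hr := degree_euler_P_lt hα t n
    set r := X * derivative (P α t (n + 2)) - C (n + 2 : ℝ) * P α t (n + 2) -
      C (2 * ∑ j ∈ Finset.range (n + 2), β α j t) * P α t n with hr'
    have e : X ^ 2 * derivative (P α t (n + 2)) * P α t (n + 1) =
        C (n + 2 : ℝ) * (P α t (n + 2) * P α t (n + 2)) +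
        (C (2 * s + β α (n + 1) t * (n + 2)) * (P α t (n + 2) * P α t n) +
        (C (2 * s * β α (n + 1) t) * (P α t n * P α t n) +
        (P α t (n + 2) * r + C (β α (n + 1) t) * (P α t n * r)))) := by
      have h1 : X * derivative (P α t (n + 2)) = C (n + 2 : ℝ) * P α t (n + 2) +
        C (2 * s) * P α t n + r := by rw [hr']; ring
      have h2 := (recurrence hα t).2.2 n
      rw [C_mul (a := 2 * s), C_add (a := 2 * s), C_mul (a := β α (n + 1) t)]
      linear_combination (X * P α t (n + 1)) * h1 +
        (C (n + 2 : ℝ) * P α t (n + 2) + C (2 * s) * P α t n + r) * h2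
    have hb := β_succ_mul_h hα t n
    rw [e, functional_add hα, functional_add hα, functional_add hα, functional_add hα,
      functional_C_mul, functional_C_mul, functional_C_mul, functional_C_mul,
      P_orthogonal hα t (by omega : n + 2 ≠ n),
      P_orthogonal_of_degree_lt hα t (n + 2) n (by omega) _ hr,
      P_orthogonal_of_degree_lt hα t n n le_rfl _ hr, ← h, ← h]
    push_cast
    linear_combination 2 * s * hb

theorem functional_X_mul_P_mul_P {α : ℝ} (hα : -1 < α) (t : ℝ) (n : ℕ) :
    functional α t (X * (P α t (n + 1) * P α t n)) = h α (n + 1) t := by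
  rw [show X * (P α t (n + 1) * P α t n) = P α t (n + 1) * (X * P α t n) by ring,
    functional_P_mul hα, coeff_X_mul, P_coeff_self, one_mul]
  rw [degree_mul, degree_X, P_degree]
  exact_mod_cast (by omega : 1 + n < n + 1 + 1)

theorem functional_X_pow_three_mul_P_mul_P {α : ℝ} (hα : -1 < α) (t : ℝ) (n : ℕ) :
    functional α t (X ^ 3 * (P α t (n + 1) * P α t n)) =
      (β α n t + β α (n + 1) t + β α (n + 2) t) * h α (n + 1) t := by
  have e : X ^ 3 * (P α t (n + 1) * P α t n) = X ^ 2 * (P α t (n + 1) * P α t (n + 1)) +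
      C (β α n t) * (P α t (n + 1) * (X ^ 2 * P α t (n - 1))) := by
    linear_combination (X ^ 2 * P α t (n + 1)) * X_mul_P hα t n
  have h1 : β α n t * functional α t (P α t (n + 1) * (X ^ 2 * P α t (n - 1))) =
      β α n t * h α (n + 1) t := by
    cases n with
    | zero => simp [β_zero]
    | succ n =>
      rw [Nat.add_sub_cancel, functional_P_mul hα, coeff_X_pow_mul, P_coeff_self, one_mul]
      rw [degree_mul, degree_X_pow, P_degree]
      exact_mod_cast (by omega : 2 + n < n + 1 + 1 + 1)
  rw [e, functional_add hα, functional_C_mul, h1, functional_X_sq_mul_P_sq hα]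
  ring

/-! ### String equation and first integral -/

/-- The string equation: the Pearson equation tested on `P_n P_{n-1}`. -/
theorem string_equation {α : ℝ} (hα : -1 < α) (t : ℝ) (n : ℕ) :
    n - 2 * ∑ j ∈ Finset.range n, β α j t =
      β α n t * (2 * n + 1 + 2 * α + 2 * t -
        2 * t * (β α (n - 1) t + β α n t + β α (n + 1) t)) := by
  cases n with
  | zero => simp [β_zero]
  | succ n =>
    have hp := functional_pearson hα t (P α t (n + 1) * P α t n)
    have e1 : (1 - X ^ 2) * derivative (P α t (n + 1) * P α t n) =
        (derivative (P α t (n + 1)) * P α t n + P α t (n + 1) * derivative (P α t n)) -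
        (X ^ 2 * derivative (P α t (n + 1)) * P α t n +
          P α t (n + 1) * (X ^ 2 * derivative (P α t n))) := by
      rw [derivative_mul]; ring
    have e2 : (C (2 * (1 + α + t)) * X - C (2 * t) * X ^ 3) * (P α t (n + 1) * P α t n) =
        C (2 * (1 + α + t)) * (X * (P α t (n + 1) * P α t n)) -
        C (2 * t) * (X ^ 3 * (P α t (n + 1) * P α t n)) := by ring
    rw [e1, e2, functional_sub hα, functional_sub hα, functional_add hα, functional_add hα,
      functional_C_mul, functional_C_mul, functional_derivative_P_mul hα,
      functional_P_mul_derivative hα, functional_X_sq_derivative_P_mul hα,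
      functional_P_mul_X_sq_derivative hα, functional_X_mul_P_mul_P hα,
      functional_X_pow_three_mul_P_mul_P hα, ← β_succ_mul_h hα t n] at hp
    rw [Nat.add_sub_cancel]
    refine mul_right_cancel₀ (h_pos hα n t).ne' ?_
    push_cast
    linear_combination hp

/-- The quantity `R_n = 2n + 1 + 2α - 2t (β_n + β_{n+1})`, which occurs in the lowering
relation `P_n' = β_n (2t + R_n / (1 - x²)) P_{n-1} - x r_n / (1 - x²) P_n`. -/
def R (α : ℝ) (n : ℕ) (t : ℝ) : ℝ := 2 * n + 1 + 2 * α - 2 * t * (β α n t + β α (n + 1) t)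

/-- The difference of two consecutive string equations; the sums of the `β_j` cancel. For `n = 0`
the index `n - 1` is truncated, and the term containing it is zero. -/
theorem string_equation_sub {α : ℝ} (hα : -1 < α) (t : ℝ) (n : ℕ) :
    1 - 2 * t * (β α (n + 1) t - β α n t) =
      β α (n + 1) t * R α (n + 1) t -
        β α n t * (2 * n - 1 + 2 * α - 2 * t * (β α n t + β α (n - 1) t)) := by
  have h0 := string_equation hα t n
  have h1 := string_equation hα t (n + 1)
  rw [Finset.sum_range_succ, Nat.add_sub_cancel] at h1
  simp only [R]
  push_cast at h1 ⊢
  linear_combination h1 - h0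

/-- A first integral: multiplied by `R_n`, the differenced string equation telescopes. -/
theorem β_mul_R_mul_R {α : ℝ} (hα : -1 < α) (t : ℝ) (n : ℕ) :
    (n + 1 - 2 * t * β α (n + 1) t) * (n + 1 + 2 * α - 2 * t * β α (n + 1) t) =
      β α (n + 1) t * R α (n + 1) t * R α n t := by
  induction n with
  | zero =>
    have := string_equation_sub hα t 0
    simp only [β_zero, R] at this ⊢
    push_cast at this ⊢
    linear_combination (1 + 2 * α - 2 * t * β α 1 t) * this
  | succ n ih =>
    have := string_equation_sub hα t (n + 1)
    simp only [R, Nat.add_sub_cancel] at this ih ⊢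
    push_cast at this ih ⊢
    linear_combination ih +
      (2 * n + 3 + 2 * α - 2 * t * (β α (n + 1) t + β α (n + 2) t)) * this

/-! ### The second-order differential equation -/

theorem differentiable_deriv_β {α : ℝ} (hα : -1 < α) (n : ℕ) :
    Differentiable ℝ (deriv (β α n)) := by
  rw [funext (deriv_β hα n)]
  exact (differentiable_β hα n).mul ((differentiable_β hα _).sub (differentiable_β hα _))

theorem deriv_deriv_β {α : ℝ} (hα : -1 < α) (n : ℕ) (t : ℝ) :
    deriv (deriv (β α n)) t = deriv (β α n) t * (β α (n - 1) t - β α (n + 1) t) +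
      β α n t * (deriv (β α (n - 1)) t - deriv (β α (n + 1)) t) := by
  have hd := fun k => (differentiable_β hα k t).hasDerivAt
  have e : deriv (β α n) = β α n * (β α (n - 1) - β α (n + 1)) := funext (deriv_β hα n)
  conv_lhs => rw [e]
  exact ((hd n).mul ((hd (n - 1)).sub (hd (n + 1)))).deriv

/-- `q = (t β_n)'` in terms of the quantities `R_n` and `R_{n-1}`. -/
theorem two_mul_deriv_mul_β {α : ℝ} (hα : -1 < α) (n : ℕ) (t : ℝ) :
    2 * (t * deriv (β α (n + 1)) t + β α (n + 1) t) =
      β α (n + 1) t * (R α (n + 1) t - R α n t) := by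
  rw [deriv_β hα, Nat.add_sub_cancel, R, R]
  push_cast
  ring

/-- `t q'` for `q = (t β_n)'`. The Toda equation brings in `β_{n-2}` and `β_{n+2}`, which the
differenced string equations at `n - 1` and `n` eliminate. -/
theorem four_mul_deriv_deriv_mul_β {α : ℝ} (hα : -1 < α) (n : ℕ) (t : ℝ) :
    4 * (t * (t * deriv (deriv (β α (n + 1))) t + 2 * deriv (β α (n + 1)) t)) =
      β α (n + 1) t * (-2 * R α (n + 1) t * R α n t - (R α (n + 1) t - R α n t) +
        (R α (n + 1) t + R α n t) *
          (2 * α + 2 * (n + 1 - 2 * t * β α (n + 1) t) - 2 * t) +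
        4 * t * (2 * α + 2 * (n + 1 - 2 * t * β α (n + 1) t))) := by
  have h0 := string_equation_sub hα t n
  have h1 := string_equation_sub hα t (n + 1)
  rw [deriv_deriv_β hα, deriv_β hα, deriv_β hα, deriv_β hα]
  simp only [Nat.add_sub_cancel, R] at h0 h1 ⊢
  push_cast at h0 h1 ⊢
  linear_combination (2 * t * β α (n + 1) t) * h1 - (2 * t * β α (n + 1) t) * h0

/-- The differential equation before squaring: its square root is `2 t β_n (R_n + R_{n-1})`, up to
sign. Here `b = β_n`, `q = (t β_n)'`, `dq = q'`, `r = n - 2 t β_n`, `R₁ = R_n`, `R₀ = R_{n-1}`. -/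
theorem unsquared_ode {ν α t b q dq r R₀ R₁ : ℝ} (hr : r = ν - 2 * t * b)
    (hq : 2 * q = b * (R₁ - R₀)) (hR : r * (r + 2 * α) = b * R₁ * R₀)
    (hdq : 4 * (t * dq) = b * (-2 * R₁ * R₀ - (R₁ - R₀) +
      (R₁ + R₀) * (2 * α + 2 * r - 2 * t) + 4 * t * (2 * α + 2 * r))) :
    8 * t ^ 2 * q * dq + 4 * t * (2 * t - 2 * ν + 1 - 2 * α + 4 * t * b) * q ^ 2
        - 4 * t * q * (2 * ν * α + 2 * (ν - 2 * α) * r - 3 * r ^ 2)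
        + 4 * r ^ 4 - 4 * (ν - 3 * α + t) * r ^ 3
        + 4 * (ν * (t - 3 * α) - 2 * α * (t - α)) * r ^ 2
        + 8 * ν * α * (t - α) * r
      = -((2 * t * dq + (2 * t - 2 * α + 1 - 2 * r) * q
          + 3 * r ^ 2 - 2 * (ν - 2 * α) * r - 2 * ν * α) * (2 * t * b * (R₁ + R₀))) := by
  obtain rfl : q = b * (R₁ - R₀) / 2 := by linarith
  obtain rfl : ν = r + 2 * t * b := by linarith
  linear_combination (t * b * (R₁ - R₀) + t * b * (R₁ + R₀)) * hdq +
    (2 * t * b) * (2 * R₁ - 2 * (2 * α + 2 * r - 2 * t)) * hR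

/-! ### Initial values -/

/-- Valid also where a denominator of the quotient form vanishes. -/
theorem β_at_zero_mul {α : ℝ} (hα : -1 < α) (n : ℕ) :
    β α n 0 * ((2 * n - 1 + 2 * α) * (2 * n + 1 + 2 * α)) = n * (n + 2 * α) := by
  cases n with
  | zero => simp [β_zero]
  | succ n =>
    have := β_mul_R_mul_R hα 0 n
    simp only [R] at this
    push_cast at this ⊢
    linear_combination -this

theorem β_at_zero {α : ℝ} (hα : -1 < α) (n : ℕ)
    (hn : (2 * n - 1 + 2 * α) * (2 * n + 1 + 2 * α) ≠ 0) :
    β α n 0 = n * (n + 2 * α) / ((2 * n - 1 + 2 * α) * (2 * n + 1 + 2 * α)) :=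
  eq_div_of_mul_eq hn (β_at_zero_mul hα n)

theorem deriv_β_at_zero {α : ℝ} (hα : -1 < α) (n : ℕ)
    (hn : (2 * n - 1 + 2 * α) ^ 2 * (2 * n + 1 + 2 * α) ^ 2 * (2 * n - 3 + 2 * α) *
        (2 * n + 3 + 2 * α) ≠ 0) :
    deriv (β α n) 0 = 4 * n * (n + α) * (n + 2 * α) * (1 - 4 * α ^ 2) /
      ((2 * n - 1 + 2 * α) ^ 2 * (2 * n + 1 + 2 * α) ^ 2 * (2 * n - 3 + 2 * α) *
        (2 * n + 3 + 2 * α)) := by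
  refine eq_div_of_mul_eq hn ?_
  rw [deriv_β hα]
  cases n with
  | zero => simp [β_zero]
  | succ n =>
    have h0 := β_at_zero_mul hα n
    have h1 := β_at_zero_mul hα (n + 1)
    have h2 := β_at_zero_mul hα (n + 2)
    rw [Nat.add_sub_cancel]
    push_cast at h0 h1 h2 hn ⊢
    set y := β α n 0
    set b := β α (n + 1) 0
    set z := β α (n + 1 + 1) 0
    set x := (n : ℝ)
    have e : (y - z) * ((2 * x - 1 + 2 * α) * (2 * x + 1 + 2 * α) * (2 * x + 3 + 2 * α) *
        (2 * x + 5 + 2 * α)) = 4 * (x + 1 + α) * (1 - 4 * α ^ 2) := by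
      linear_combination ((2 * x + 3 + 2 * α) * (2 * x + 5 + 2 * α)) * h0 -
        ((2 * x - 1 + 2 * α) * (2 * x + 1 + 2 * α)) * h2
    linear_combination
      (b * ((2 * x + 1 + 2 * α) * (2 * x + 3 + 2 * α))) * e +
        4 * (x + 1 + α) * (1 - 4 * α ^ 2) * h1

end SemiJacobi

end

theorem mainTheorem7 (α : ℝ) (hα : -1 < α) (n : ℕ) :
    -- `β_n` is twice differentiable in `t ∈ ℝ`
    (Differentiable ℝ (SemiJacobi.β α n) ∧ Differentiable ℝ (deriv (SemiJacobi.β α n))) ∧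
    -- the differential equation, with `b = β_n(t)`, `b' = β_n'(t)`, `b'' = β_n''(t)`
    (∀ t b b' b'' r : ℝ, b = SemiJacobi.β α n t → b' = deriv (SemiJacobi.β α n) t →
      b'' = deriv (deriv (SemiJacobi.β α n)) t → r = n - 2 * t * b →
      (8 * t ^ 2 * (t * b' + b) * (t * b'' + 2 * b')
          + 4 * t * (2 * t - 2 * n + 1 - 2 * α + 4 * t * b) * (t * b' + b) ^ 2
          - 4 * t * (t * b' + b) * (2 * n * α + 2 * (n - 2 * α) * r - 3 * r ^ 2)
          + 4 * r ^ 4 - 4 * (n - 3 * α + t) * r ^ 3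
          + 4 * (n * (t - 3 * α) - 2 * α * (t - α)) * r ^ 2
          + 8 * n * α * (t - α) * r) ^ 2
        = (2 * t * (t * b'' + 2 * b') + (2 * t - 2 * α + 1 - 2 * r) * (t * b' + b)
            + 3 * r ^ 2 - 2 * (n - 2 * α) * r - 2 * n * α) ^ 2
          * (16 * t ^ 2 * (b * r * (n + 2 * α - 2 * t * b) + (t * b' + b) ^ 2))) ∧
    -- the initial value `β_n(0)`
    ((2 * n - 1 + 2 * α) * (2 * n + 1 + 2 * α) ≠ 0 →
      SemiJacobi.β α n 0 = n * (n + 2 * α) / ((2 * n - 1 + 2 * α) * (2 * n + 1 + 2 * α))) ∧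
    -- the initial value `β_n'(0)`
    ((2 * n - 1 + 2 * α) ^ 2 * (2 * n + 1 + 2 * α) ^ 2 * (2 * n - 3 + 2 * α) *
        (2 * n + 3 + 2 * α) ≠ 0 →
      deriv (SemiJacobi.β α n) 0 =
        4 * n * (n + α) * (n + 2 * α) * (1 - 4 * α ^ 2) /
          ((2 * n - 1 + 2 * α) ^ 2 * (2 * n + 1 + 2 * α) ^ 2 * (2 * n - 3 + 2 * α) *
            (2 * n + 3 + 2 * α))) ∧
    -- the values in the cases with `n ≥ 1` where a denominator vanishes
    (n = 1 → α = -1 / 2 → SemiJacobi.β α n 0 = 1 / 2 ∧ deriv (SemiJacobi.β α n) 0 = -1 / 8) ∧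
    (n = 1 → α = 1 / 2 → deriv (SemiJacobi.β α n) 0 = -1 / 16) ∧
    (n = 2 → α = -1 / 2 → deriv (SemiJacobi.β α n) 0 = 1 / 16) := by
  -- at `n = 1`, `t = 0` the string equation determines `β_1(0)` for every `α > -1`
  have hβ1 : SemiJacobi.β α 1 0 * (3 + 2 * α) = 1 := by
    have := SemiJacobi.string_equation hα 0 1
    simp [SemiJacobi.β_zero] at this
    linear_combination -this
  have hβ2 := SemiJacobi.β_at_zero_mul hα 2
  have hβ3 := SemiJacobi.β_at_zero_mul hα 3
  push_cast at hβ2 hβ3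
  refine ⟨⟨SemiJacobi.differentiable_β hα n, SemiJacobi.differentiable_deriv_β hα n⟩, ?_,
    SemiJacobi.β_at_zero hα n, SemiJacobi.deriv_β_at_zero hα n, ?_, ?_, ?_⟩
  · rintro t b b' b'' r hb hb' hb'' hr
    cases n with
    | zero =>
      have hz : SemiJacobi.β α 0 = fun _ => 0 := rfl
      simp only [hz, deriv_const', deriv_const] at hb hb' hb''
      subst hb hb' hb''
      simp at hr
      simp [hr]
    | succ n =>
      have hq := SemiJacobi.two_mul_deriv_mul_β hα n t
      have hR := SemiJacobi.β_mul_R_mul_R hα t n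
      have hdq := SemiJacobi.four_mul_deriv_deriv_mul_β hα n t
      rw [← hb'', ← hb', ← hb] at hdq
      rw [← hb', ← hb] at hq
      rw [← hb] at hR
      push_cast at hr ⊢
      rw [← hr] at hdq hR
      have hR' : r * (r + 2 * α) =
          b * SemiJacobi.R α (n + 1) t * SemiJacobi.R α n t := by
        rw [← hR, hr]; ring
      rw [SemiJacobi.unsquared_ode hr hq hR' hdq, neg_sq, mul_pow]
      congr 1
      -- `q² + b r (r + 2α) = (b (R₁ + R₀) / 2)²`, as `2 q = b (R₁ - R₀)` and
      -- `r (r + 2α) = b R₁ R₀`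
      linear_combination (-16 * t ^ 2 * b) * hR - (4 * t ^ 2) *
        (2 * (t * b' + b) + b * (SemiJacobi.R α (n + 1) t - SemiJacobi.R α n t)) * hq
  · rintro rfl rfl
    have h1 : SemiJacobi.β (-1 / 2) 1 0 = 1 / 2 := by linarith
    have h2 : SemiJacobi.β (-1 / 2) 2 0 = 1 / 4 := by linarith
    refine ⟨h1, ?_⟩
    rw [SemiJacobi.deriv_β hα, h1, h2, SemiJacobi.β_zero]
    norm_num
  · rintro rfl rfl
    have h1 : SemiJacobi.β (1 / 2) 1 0 = 1 / 4 := by linarith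
    have h2 : SemiJacobi.β (1 / 2) 2 0 = 1 / 4 := by linarith
    rw [SemiJacobi.deriv_β hα, h1, h2, SemiJacobi.β_zero]
    norm_num
  · rintro rfl rfl
    have h1 : SemiJacobi.β (-1 / 2) 1 0 = 1 / 2 := by linarith
    have h2 : SemiJacobi.β (-1 / 2) 2 0 = 1 / 4 := by linarith
    have h3 : SemiJacobi.β (-1 / 2) 3 0 = 1 / 4 := by linarith
    rw [SemiJacobi.deriv_β hα, h2, h3, h1]
    norm_num
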